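/- Conventions. A $\ast$-algebra is an associative unital algebra with involution over $F\in\{\mathbb R,\mathbb C\}$ (the involution on $F$ being complex conjugation). For a $\ast$-algebra $B$ let $B_h=\{b\in B: b^\ast=b\}$ and let $\Sigma^2B$ be the set of all finite sums of elements $b^\ast b$, $b\in B$. A quadratic module in $B$ is a subset $M\subseteq B_h$ with $1\in M$, $M+M\subseteq M$ and $b^\ast Mb\subseteq M$ for every $b\in B$. It is archimedean if for every $b\in B_h$ there is $l\in\mathbb N$ with $l+b\in M$ and $l-b\in M$. A $\ast$-algebra $A$ is algebraically bounded if $\Sigma^2A$ is archimedean. A multiplicative state on a commutative real algebra $R$ (with trivial involution) is a linear functional $\phi\colon R\to\mathbb R$ with $\phi(1)=1$, $\phi(\Sigma^2R)\ge 0$ and $\phi(rs)=\phi(r)\phi(s)$ for all $r,s\in R$. Theorem. Let $R$ be a commutative unital real algebra with trivial involution, $A$ a $\ast$-algebra over $F\in\{\mathbb R,\mathbb C\}$, $B:=R\otimes_{\mathbb R}A$, and $M$ a quadratic module in $B$. For $\phi\colon R\to\mathbb R$ linear, $\phi\otimes\mathrm{id}_A\colon B\to A$ is the linear map with $r\otimes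 a\mapsto\phi(r)a$. (a) If $M$ is archimedean, then for every $p\in B_h=R\otimes A_h$ the following three equivalences hold. (1) $p\in\varepsilon+M$ for some real $\varepsilon>0$ if and only if (2) for every multiplicative state $\phi$ on $R$ there is a real $\varepsilon_\phi>0$ such that $(\phi\otimes\mathrm{id}_A)(p)\in\varepsilon_\phi+(\phi\otimes\mathrm{id}_A)(M)$. (1') $p+\varepsilon\in M$ for every real $\varepsilon>0$ if and only if (2') for every multiplicative state $\phi$ on $R$ and every real $\varepsilon>0$ we have $(\phi\otimes\mathrm{id}_A)(p)+\varepsilon\in(\phi\otimes\mathrm{id}_A)(M)$. (1'') There are finitely many $c_i\in B$ such that $\sum_i c_i^\ast p\,c_i\in 1+M$ if and only if (2'') for every multiplicative state $\phi$ on $R$ there are finitely many $d_i\in A$ such that $\sum_i d_i^\ast(\phi\otimes\mathrm{id}_A)(p)\,d_i\in 1+(\phi\otimes\mathrm{id}_A)(M)$. (b) If $A$ is algebraically bounded and the quadratic module $M\cap R=\{r\in R: r\otimes 1\in M\}$ in $R$ is archimedean, then $M$ is archimedean. -/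

import Mathlib

open scoped TensorProduct

/-- The set `Σ² B` of all finite sums of elements `b* b` with `b ∈ B`. -/
def sumsOfHermitianSquares (B : Type*) [Ring B] [StarRing B] : Set B :=
  {x | ∃ (k : ℕ) (b : Fin k → B), x = ∑ i, star (b i) * b i}

/-- A quadratic module in a `*`-algebra `B`: a set `M` of hermitian elements with `1 ∈ M`,
`M + M ⊆ M` and `b* M b ⊆ M` for every `b ∈ B`. -/
structure IsQuadraticModule {B : Type*} [Ring B] [StarRing B] (M : Set B) : Prop where
  isSelfAdjoint : ∀ m ∈ M, IsSelfAdjoint m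
  one_mem : 1 ∈ M
  add_mem : ∀ m ∈ M, ∀ n ∈ M, m + n ∈ M
  conj_mem : ∀ b : B, ∀ m ∈ M, star b * m * b ∈ M

/-- The archimedean property: for every hermitian `b` there is a natural number `l` such that
`l + b` and `l - b` both lie in `M`. -/
def IsArchimedean {B : Type*} [Ring B] [StarRing B] (M : Set B) : Prop :=
  ∀ b : B, IsSelfAdjoint b → ∃ l : ℕ, (l : B) + b ∈ M ∧ (l : B) - b ∈ M

/-- A `*`-algebra is algebraically bounded if `Σ² A` is archimedean. -/
def IsAlgebraicallyBounded (A : Type*) [Ring A] [StarRing A] : Prop :=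
  IsArchimedean (sumsOfHermitianSquares A)

/-- A multiplicative state on a commutative real algebra `R` with trivial involution (so that every
element of `R` is hermitian): a real linear functional which is unital, nonnegative on `Σ² R`,
and multiplicative. -/
structure IsMultiplicativeState {R : Type*} [CommRing R] [StarRing R] [Algebra ℝ R]
    (φ : R →ₗ[ℝ] ℝ) : Prop where
  map_one : φ 1 = 1
  nonneg : ∀ x ∈ sumsOfHermitianSquares R, 0 ≤ φ x
  map_mul : ∀ r s : R, φ (r * s) = φ r * φ s

/-- The map `φ ⊗ id : R ⊗ A → A`, `r ⊗ a ↦ φ(r) a`. -/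
noncomputable def evalTensor {R : Type*} (A : Type*) [CommRing R] [Algebra ℝ R] [Ring A]
    [Algebra ℝ A] (φ : R →ₗ[ℝ] ℝ) : R ⊗[ℝ] A →ₗ[ℝ] A :=
  (TensorProduct.lid ℝ A).toLinearMap ∘ₗ LinearMap.rTensor A φ

theorem evalTensor_tmul {R A : Type*} [CommRing R] [Algebra ℝ R] [Ring A] [Algebra ℝ A]
    (φ : R →ₗ[ℝ] ℝ) (r : R) (a : A) : evalTensor A φ (r ⊗ₜ[ℝ] a) = φ r • a := by
  simp [evalTensor]

/-! The forward implications come from applying the unital $\ast$-homomorphism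
$\phi\otimes\mathrm{id}_A$. For the converse of (1), suppose $p-\varepsilon\notin M$ for all
$\varepsilon>0$. Since $1$ is an order unit, a separation argument gives an $M$-positive state with
value $\le 0$ at $p$, and by compactness an extreme one, $G$. Extremality forces
$G((r\otimes1)b)=G(r\otimes1)G(b)$, because $R\otimes1$ is central and its elements are differences
of squares. Hence $G=g\circ(\phi\otimes\mathrm{id}_A)$ with $\phi$ a multiplicative state, which
contradicts (2) (`exists_factorization_nonpos`). The converse of (1') is (1) for shifted $p$; that
of (1'') applies the factorization to $-1$ and the quadratic module of all $x$ with $x+\sum c_i^\ast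
pc_i\in M$. Positivity is tested on $\{b: b+b^\ast\in M\}$, so that functionals live on all of $B$
and vanish on skew elements. -/

namespace IsQuadraticModule

variable {B : Type*} [Ring B] [StarRing B] {M : Set B}

theorem zero_mem (hM : IsQuadraticModule M) : 0 ∈ M := by
  simpa using hM.conj_mem 0 1 hM.one_mem

theorem sum_mem (hM : IsQuadraticModule M) {ι : Type*} (s : Finset ι) (f : ι → B)
    (hf : ∀ i ∈ s, f i ∈ M) : ∑ i ∈ s, f i ∈ M :=
  Finset.sum_induction f (· ∈ M) (fun a b ha hb => hM.add_mem a ha b hb) hM.zero_mem hf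

variable [Algebra ℝ B] [StarModule ℝ B]

theorem smul_mem (hM : IsQuadraticModule M) {t : ℝ} (ht : 0 ≤ t) {m : B} (hm : m ∈ M) :
    t • m ∈ M := by
  have h := hM.conj_mem (algebraMap ℝ B (√t)) m hm
  rw [← algebraMap_star_comm, star_trivial, mul_assoc, ← Algebra.commutes, ← mul_assoc,
    ← map_mul, Real.mul_self_sqrt ht, ← Algebra.smul_def] at h
  exact h

theorem algebraMap_mem (hM : IsQuadraticModule M) {t : ℝ} (ht : 0 ≤ t) :
    algebraMap ℝ B t ∈ M := by
  rw [Algebra.algebraMap_eq_smul_one]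
  exact hM.smul_mem ht hM.one_mem

end IsQuadraticModule

theorem IsArchimedean.mono {B : Type*} [Ring B] [StarRing B] {M N : Set B}
    (hM : IsArchimedean M) (h : M ⊆ N) : IsArchimedean N := fun b hb =>
  let ⟨l, h₁, h₂⟩ := hM b hb
  ⟨l, h h₁, h h₂⟩

/-- The elements `b` of a `*`-algebra with `b + star b ∈ M`. -/
def realPartCone {B : Type*} [Ring B] [StarRing B] (M : Set B) : Set B :=
  {b | b + star b ∈ M}

namespace realPartCone

variable {B : Type*} [Ring B] [StarRing B] {M : Set B}

theorem subset (hM : IsQuadraticModule M) : M ⊆ realPartCone M := fun m hm => by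
  have h : m + star m = m + m := by rw [(hM.isSelfAdjoint m hm).star_eq]
  rw [realPartCone, Set.mem_ofPred_eq, h]
  exact hM.add_mem m hm m hm

theorem sq_mul_mem (hM : IsQuadraticModule M) {u : B} (hu : ∀ b, Commute u b)
    (hus : IsSelfAdjoint u) {b : B} (hb : b ∈ realPartCone M) : u * u * b ∈ realPartCone M := by
  have h := hM.conj_mem u _ hb
  rw [realPartCone, Set.mem_ofPred_eq, star_mul, star_mul, hus.star_eq]
  convert h using 1
  rw [hus.star_eq, ← ((hu (star b)).mul_left (hu (star b))).eq, ← mul_add, mul_assoc, mul_assoc,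
    (hu (b + star b)).eq]

variable [Algebra ℝ B] [StarModule ℝ B]

theorem exists_add_sub_mem (hA : IsArchimedean M) (b : B) :
    ∃ l : ℝ, 0 ≤ l ∧ l • (1 : B) + b ∈ realPartCone M ∧ l • (1 : B) - b ∈ realPartCone M := by
  obtain ⟨l, h₁, h₂⟩ := hA (b + star b) (IsSelfAdjoint.add_star_self b)
  have hl : ((l : ℝ) / 2) • (1 : B) + ((l : ℝ) / 2) • (1 : B) = l := by
    rw [← add_smul, add_halves, Nat.cast_smul_eq_nsmul, nsmul_one]
  refine ⟨l / 2, by positivity, ?_, ?_⟩ <;>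
    rw [realPartCone, Set.mem_ofPred_eq]
  · convert h₁ using 1
    rw [← hl, star_add, star_smul, star_trivial, star_one]
    abel
  · convert h₂ using 1
    rw [← hl, star_sub, star_smul, star_trivial, star_one]
    abel

end realPartCone

/-- The states of `B` that are nonnegative on `M`, as a subset of `B → ℝ`. -/
def positiveStates {B : Type*} [Ring B] [StarRing B] [Algebra ℝ B] (M : Set B) : Set (B → ℝ) :=
  {f | ∃ g : B →ₗ[ℝ] ℝ, (∀ b ∈ realPartCone M, 0 ≤ g b) ∧ g 1 = 1 ∧ ⇑g = f}

/-! ### States positive on an archimedean quadratic module -/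

section States

variable {B : Type*} [Ring B] [StarRing B] [Algebra ℝ B] [StarModule ℝ B] {M : Set B}

theorem exists_abs_le_mul_apply_one (hA : IsArchimedean M) (b : B) :
    ∃ l : ℝ, ∀ g : B →ₗ[ℝ] ℝ, (∀ b ∈ realPartCone M, 0 ≤ g b) → |g b| ≤ l * g 1 := by
  obtain ⟨l, -, h₁, h₂⟩ := realPartCone.exists_add_sub_mem hA b
  refine ⟨l, fun g hg => ?_⟩
  have h₁ := hg _ h₁
  have h₂ := hg _ h₂
  simp only [map_add, map_sub, map_smul, smul_eq_mul] at h₁ h₂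
  exact abs_le.2 ⟨by linarith, by linarith⟩

theorem isCompact_positiveStates (hA : IsArchimedean M) :
    IsCompact (positiveStates M) := by
  choose l hl using exists_abs_le_mul_apply_one hA
  have hK : positiveStates M = Set.range ((↑) : (B →ₗ[ℝ] ℝ) → B → ℝ) ∩
      ({f | ∀ b ∈ realPartCone M, 0 ≤ f b} ∩ {f | f 1 = 1}) := by
    ext f
    constructor
    · rintro ⟨g, h₁, h₂, rfl⟩
      exact ⟨⟨g, rfl⟩, h₁, h₂⟩
    · rintro ⟨⟨g, rfl⟩, h₁, h₂⟩
      exact ⟨g, h₁, h₂, rfl⟩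
  have hc : IsClosed (positiveStates M) := by
    rw [hK]
    refine (LinearMap.isClosed_range_coe B ℝ (RingHom.id ℝ)).inter (IsClosed.inter ?_ ?_)
    · simp only [Set.ofPred_forall]
      exact isClosed_iInter fun b => isClosed_iInter fun _ =>
        isClosed_le continuous_const (continuous_apply b)
    · exact isClosed_eq (continuous_apply 1) continuous_const
  refine (isCompact_univ_pi fun b => isCompact_Icc (a := -l b) (b := l b)).of_isClosed_subset hc ?_
  rintro _ ⟨g, h₁, h₂, rfl⟩ b -
  have := hl b g h₁
  rw [h₂, mul_one] at this
  exact abs_le.1 this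

/-- M. Riesz extension of $t\cdot1\mapsto t$, positive for the cone `C` obtained by adjoining $-p$
to `realPartCone M`. -/
theorem exists_positiveState_nonpos (hM : IsQuadraticModule M) (hA : IsArchimedean M) {p : B}
    (hp : IsSelfAdjoint p) (hpM : ∀ ε : ℝ, 0 < ε → p - algebraMap ℝ B ε ∉ M) :
    ∃ f ∈ positiveStates M, f p ≤ 0 := by
  have h1 : (1 : B) ≠ 0 := fun h => by
    have := subsingleton_of_zero_eq_one h.symm
    exact hpM 1 one_pos (by convert hM.zero_mem)
  let C : PointedCone ℝ B :=
    { carrier := {b | ∃ s : ℝ, 0 ≤ s ∧ b + star b + s • p ∈ M}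
      zero_mem' := ⟨0, le_rfl, by simpa using hM.zero_mem⟩
      add_mem' := by
        rintro a b ⟨s, hs, ha⟩ ⟨t, ht, hb⟩
        refine ⟨s + t, add_nonneg hs ht, ?_⟩
        convert hM.add_mem _ ha _ hb using 1
        rw [star_add, add_smul]
        abel
      smul_mem' := by
        rintro ⟨c, hc⟩ b ⟨s, hs, hb⟩
        refine ⟨c * s, mul_nonneg hc hs, ?_⟩
        convert hM.smul_mem hc hb using 1
        rw [Nonneg.mk_smul, star_smul, star_trivial, smul_add, smul_add, mul_smul] }
  have hCM : realPartCone M ⊆ C := fun b hb => ⟨0, le_rfl, by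
    rw [zero_smul, add_zero]
    exact hb⟩
  obtain ⟨g, hg₁, hg₂⟩ := riesz_extension C (LinearPMap.mkSpanSingleton (1 : B) (1 : ℝ) h1)
    (by
      rintro ⟨x, hx⟩ hxC
      obtain ⟨t, rfl⟩ := Submodule.mem_span_singleton.1 hx
      obtain ⟨s, hs, hts⟩ := hxC
      have hv : (LinearPMap.mkSpanSingleton (1 : B) (1 : ℝ) h1) ⟨t • 1, hx⟩ = t := by
        have := LinearPMap.mkSpanSingleton'_apply (R := ℝ) (1 : B) (1 : ℝ) _ t hx
        simpa using this
      rw [hv]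
      by_contra! ht
      have hts : (2 * t) • (1 : B) + s • p ∈ M := by
        convert hts using 2
        rw [star_smul, star_trivial, star_one, two_mul, add_smul]
      rcases hs.eq_or_lt with rfl | hs
      -- Here a negative constant lies in $M$, so $-l\in M$; adding $l+(p-1)\in M$ gives $p-1\in M$.
      · obtain ⟨l, hl, -⟩ := hA (p - 1) (hp.sub (IsSelfAdjoint.one B))
        rw [zero_smul, add_zero] at hts
        refine hpM 1 one_pos ?_
        have hn := hM.smul_mem (t := l / (-(2 * t)))
          (div_nonneg (Nat.cast_nonneg l) (by linarith)) hts
        rw [smul_smul, div_mul_eq_mul_div, mul_div_assoc, div_neg, div_self (by linarith),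
          mul_neg_one, neg_smul, Nat.cast_smul_eq_nsmul, nsmul_one] at hn
        convert hM.add_mem _ hl _ hn using 1
        rw [map_one]
        abel
      · refine hpM (-(2 * t) / s) (div_pos (by linarith) hs) ?_
        convert hM.smul_mem (inv_nonneg.2 hs.le) hts using 1
        rw [smul_add, smul_smul, smul_smul, inv_mul_cancel₀ hs.ne', one_smul,
          Algebra.algebraMap_eq_smul_one, neg_div, neg_smul, sub_neg_eq_add, add_comm,
          div_eq_inv_mul])
    (by
      intro y
      obtain ⟨l, -, hl, -⟩ := realPartCone.exists_add_sub_mem hA y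
      exact ⟨⟨l • 1, Submodule.smul_mem _ _ (Submodule.mem_span_singleton_self _)⟩, hCM hl⟩)
  refine ⟨g, ⟨g, fun b hb => hg₂ b (hCM hb), ?_, rfl⟩, ?_⟩
  · have := hg₁ ⟨1, Submodule.mem_span_singleton_self _⟩
    rw [this]
    exact LinearPMap.mkSpanSingleton_apply ℝ ℝ h1 (1 : ℝ)
  · have : -p ∈ C := by
      refine ⟨2, zero_le_two, ?_⟩
      rw [star_neg, hp.star_eq, two_smul]
      convert hM.zero_mem using 1
      abel
    have := hg₂ _ this
    rw [map_neg] at this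
    linarith

/-- The states minimising the value at $p$ form a compact exposed face; it has extreme points, and
these are extreme in the whole state space. -/
theorem exists_extremePoint_nonpos (hM : IsQuadraticModule M) (hA : IsArchimedean M) {p : B}
    (hp : IsSelfAdjoint p) (hpM : ∀ ε : ℝ, 0 < ε → p - algebraMap ℝ B ε ∉ M) :
    ∃ f ∈ (positiveStates M).extremePoints ℝ, f p ≤ 0 := by
  obtain ⟨f₀, hf₀, hf₀p⟩ := exists_positiveState_nonpos hM hA hp hpM
  have hK := isCompact_positiveStates hA
  let e : StrongDual ℝ (B → ℝ) := -ContinuousLinearMap.proj p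
  have hE : IsExposed ℝ (positiveStates M) (e.toExposed (positiveStates M)) :=
    ContinuousLinearMap.toExposed.isExposed
  obtain ⟨f₁, hf₁, hmax⟩ := hK.exists_isMaxOn ⟨f₀, hf₀⟩ e.continuous.continuousOn
  obtain ⟨f, hf⟩ := (hE.isCompact hK).extremePoints_nonempty ⟨f₁, hf₁, hmax⟩
  refine ⟨f, hE.isExtreme.extremePoints_subset_extremePoints hf, ?_⟩
  have h : e f₀ ≤ e f := (extremePoints_subset hf).2 f₀ hf₀
  have h' : -f₀ p ≤ -f p := h
  linarith

/-- A bounded sequence with `c j ^ 2 ≤ c (j + 1) * G` starts below `G`. -/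
theorem le_of_sq_le_succ_mul {c : ℕ → ℝ} {G L : ℝ} (hG : 0 ≤ G)
    (hc : ∀ j, c j ^ 2 ≤ c (j + 1) * G) (hL : ∀ j, c j ≤ L) : c 0 ≤ G := by
  by_contra! h
  have hG' : 0 < G := by
    rcases hG.eq_or_lt with rfl | h'
    · have := hc 0
      nlinarith [pow_pos h 2]
    · exact h'
  have key : ∀ j : ℕ, c 0 + j * (c 0 - G) ≤ c j := by
    intro j
    induction j with
    | zero => simp
    | succ j ih =>
      have hj : c 0 ≤ c j := by
        have : 0 ≤ (j : ℝ) * (c 0 - G) := mul_nonneg (Nat.cast_nonneg j) (by linarith)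
        linarith
      -- Since $c_j\ge c_0>G$, $c_j(c_j-G)\ge G(c_0-G)$: growth is at least linear.
      have : (c j + (c 0 - G)) * G ≤ c (j + 1) * G := by nlinarith [hc j]
      have := le_of_mul_le_mul_right this hG'
      push_cast
      linarith
  obtain ⟨j, hj⟩ := exists_nat_gt ((L - c 0) / (c 0 - G))
  rw [div_lt_iff₀ (by linarith)] at hj
  linarith [key j, hL j]

/-- The product $(1-s^2)b$ need not lie in the cone, so the bound comes from iterating
Cauchy–Schwarz, $g(s^kb)^2\le g(s^{2k}b)\,g(b)$, along $k=2^{j+1}$, where the values stay bounded.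
-/
theorem apply_sq_mul_le (hM : IsQuadraticModule M) (hA : IsArchimedean M) {g : B →ₗ[ℝ] ℝ}
    (hg : ∀ b ∈ realPartCone M, 0 ≤ g b) {s : B} (hs : ∀ b, Commute s b)
    (hss : IsSelfAdjoint s) (hs1 : 1 - s * s ∈ M) {b : B} (hb : b ∈ realPartCone M) :
    g (s * s * b) ≤ g b := by
  obtain ⟨l, hl, -, hlb⟩ := realPartCone.exists_add_sub_mem hA b
  have hpow : ∀ k, g (s ^ (2 * k)) ≤ g 1 := by
    intro k
    induction k with
    | zero => simp
    | succ k ih =>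
      have := hg _ (realPartCone.sq_mul_mem hM (fun b => (hs b).pow_left k) (hss.pow k)
        (realPartCone.subset hM hs1))
      rw [← pow_add, ← two_mul, mul_sub, mul_one, ← pow_two, ← pow_add, map_sub] at this
      rw [mul_add_one]
      linarith
  have hbound : ∀ k, g (s ^ (2 * k) * b) ≤ l * g 1 := by
    intro k
    have := hg _ (realPartCone.sq_mul_mem hM (fun b => (hs b).pow_left k) (hss.pow k) hlb)
    rw [← pow_add, ← two_mul, mul_sub, mul_smul_comm, mul_one, map_sub, map_smul,
      smul_eq_mul] at this
    linarith [mul_le_mul_of_nonneg_left (hpow k) hl]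
  have hcs : ∀ k, g (s ^ k * b) ^ 2 ≤ g (s ^ (2 * k) * b) * g b := by
    intro k
    -- The quadratic is $g((s^k+t)^2b)$, whose discriminant is then nonpositive.
    have h : ∀ t : ℝ, 0 ≤ g b * (t * t) + 2 * g (s ^ k * b) * t + g (s ^ (2 * k) * b) := by
      intro t
      have := hg _ (realPartCone.sq_mul_mem hM
        (u := s ^ k + algebraMap ℝ B t)
        (fun b => ((hs b).pow_left k).add_left (Algebra.commutes t b))
        ((hss.pow k).add (IsSelfAdjoint.algebraMap B (IsSelfAdjoint.all t))) hb)
      have e : (s ^ k + algebraMap ℝ B t) * (s ^ k + algebraMap ℝ B t) * b =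
          (t * t) • b + (2 * t) • (s ^ k * b) + s ^ (2 * k) * b := by
        rw [add_mul, mul_add, mul_add, ← pow_add, ← two_mul, ← Algebra.commutes t (s ^ k),
          ← map_mul, ← Algebra.smul_def, Algebra.algebraMap_eq_smul_one, add_mul, add_mul, add_mul,
          smul_mul_assoc, smul_mul_assoc, one_mul, two_mul t, add_smul]
        abel
      rw [e, map_add, map_add, map_smul, map_smul, smul_eq_mul, smul_eq_mul] at this
      linarith
    have := discrim_le_zero h
    rw [discrim] at this
    nlinarith
  have := le_of_sq_le_succ_mul (c := fun j => g (s ^ (2 ^ (j + 1)) * b)) (L := l * g 1) (hg b hb)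
    (fun j => by
      have := hcs (2 ^ (j + 1))
      rwa [← pow_succ'] at this)
    (fun j => by
      have := hbound (2 ^ j)
      rwa [← pow_succ'] at this)
  simpa [pow_two] using this

/-- Both $h=g(s^2\,\cdot)$ and $g-h$ are positive, so $g$ is a convex combination of their
normalisations and extremality gives $h=h(1)g$. If $h(1)$ is $0$ or $1$, one summand vanishes at
$1$, hence everywhere. -/
theorem apply_sq_mul_of_mem_extremePoints (hM : IsQuadraticModule M) (hA : IsArchimedean M)
    {g : B →ₗ[ℝ] ℝ} (hg : ⇑g ∈ (positiveStates M).extremePoints ℝ) {s : B}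
    (hs : ∀ b, Commute s b) (hss : IsSelfAdjoint s) (hs1 : 1 - s * s ∈ M) (b : B) :
    g (s * s * b) = g (s * s) * g b := by
  obtain ⟨g', hpos, hone, hgg⟩ := extremePoints_subset hg
  obtain rfl := DFunLike.coe_injective hgg
  let h : B →ₗ[ℝ] ℝ := g' ∘ₗ LinearMap.mulLeft ℝ (s * s)
  have hh : ∀ b, h b = g' (s * s * b) := fun _ => rfl
  have hh1 : h 1 = g' (s * s) := by rw [hh, mul_one]
  have hhpos : ∀ b ∈ realPartCone M, 0 ≤ h b := fun b hb =>
    hpos _ (realPartCone.sq_mul_mem hM hs hss hb)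
  have hhpos' : ∀ b ∈ realPartCone M, 0 ≤ (g' - h) b := fun b hb =>
    sub_nonneg.2 (apply_sq_mul_le hM hA hpos hs hss hs1 hb)
  have h1 : (1 : B) ∈ realPartCone M := realPartCone.subset hM hM.one_mem
  have ht₀ : 0 ≤ h 1 := hhpos 1 h1
  have ht₁ : h 1 ≤ 1 := by
    have := hhpos' 1 h1
    rw [LinearMap.sub_apply, hone] at this
    linarith
  obtain ⟨l, hl⟩ := exists_abs_le_mul_apply_one hA b
  rw [← hh, ← hh1]
  rcases ht₀.eq_or_lt with h0 | h0
  · have := hl h hhpos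
    rw [← h0, mul_zero] at this
    rw [← h0, zero_mul]
    exact abs_nonpos_iff.1 this
  rcases ht₁.eq_or_lt with h1' | h1'
  · have := hl (g' - h) hhpos'
    rw [LinearMap.sub_apply, LinearMap.sub_apply, hone, h1', sub_self, mul_zero] at this
    rw [h1', one_mul]
    exact (sub_eq_zero.1 (abs_nonpos_iff.1 this)).symm
  have e := (mem_extremePoints_iff_left.1 hg).2 (⇑((h 1)⁻¹ • h))
    ⟨(h 1)⁻¹ • h, fun b hb => mul_nonneg (inv_nonneg.2 h0.le) (hhpos b hb),
      inv_mul_cancel₀ h0.ne', rfl⟩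
    (⇑((1 - h 1)⁻¹ • (g' - h)))
    ⟨(1 - h 1)⁻¹ • (g' - h),
      fun b hb => mul_nonneg (inv_nonneg.2 (by linarith)) (hhpos' b hb), by
        rw [LinearMap.smul_apply, LinearMap.sub_apply, hone, smul_eq_mul]
        exact inv_mul_cancel₀ (by linarith), rfl⟩
    ⟨h 1, 1 - h 1, h0, by linarith, by ring, by
      ext x
      simp only [LinearMap.smul_apply, Pi.add_apply, Pi.smul_apply, LinearMap.sub_apply,
        smul_eq_mul]
      rw [mul_inv_cancel_left₀ h0.ne', mul_inv_cancel_left₀ (by linarith)]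
      ring⟩
  have e := congrFun e b
  rw [LinearMap.smul_apply, smul_eq_mul, inv_mul_eq_iff_eq_mul₀ h0.ne'] at e
  exact e

end States

theorem eq_sq_sub_sq {R : Type*} [CommRing R] [Algebra ℝ R] (r : R) :
    r = ((1 / 2 : ℝ) • (r + 1)) * ((1 / 2 : ℝ) • (r + 1)) -
      ((1 / 2 : ℝ) • (r - 1)) * ((1 / 2 : ℝ) • (r - 1)) := by
  rw [smul_mul_smul_comm, smul_mul_smul_comm, ← smul_sub,
    show (r + 1) * (r + 1) - (r - 1) * (r - 1) = (4 : ℝ) • r by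
      rw [ofNat_smul_eq_nsmul ℝ 4 r, nsmul_eq_mul]; push_cast; ring, smul_smul]
  norm_num

/-! ### Evaluation at multiplicative states and factorization of extreme states -/

section TensorProduct

variable {R : Type*} [CommRing R] [Algebra ℝ R] {A : Type*} [Ring A] [Algebra ℝ A]

theorem commute_tmul_one (r : R) (b : R ⊗[ℝ] A) : Commute (r ⊗ₜ[ℝ] (1 : A)) b := by
  induction b with
  | zero => exact Commute.zero_right _
  | add x y hx hy => exact hx.add_right hy
  | tmul s a => simp [Commute, SemiconjBy, mul_comm]

theorem evalTensor_one {φ : R →ₗ[ℝ] ℝ} (h1 : φ 1 = 1) : evalTensor A φ 1 = 1 := by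
  rw [Algebra.TensorProduct.one_def, evalTensor_tmul, h1, one_smul]

theorem evalTensor_algebraMap {φ : R →ₗ[ℝ] ℝ} (h1 : φ 1 = 1) (t : ℝ) :
    evalTensor A φ (algebraMap ℝ (R ⊗[ℝ] A) t) = algebraMap ℝ A t := by
  rw [Algebra.algebraMap_eq_smul_one, map_smul, evalTensor_one h1, Algebra.algebraMap_eq_smul_one]

theorem evalTensor_mul {φ : R →ₗ[ℝ] ℝ} (hφ : ∀ r s, φ (r * s) = φ r * φ s) (x y : R ⊗[ℝ] A) :
    evalTensor A φ (x * y) = evalTensor A φ x * evalTensor A φ y := by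
  induction x with
  | zero => simp
  | add x₁ x₂ h₁ h₂ => rw [add_mul, map_add, h₁, h₂, map_add, add_mul]
  | tmul r a =>
    induction y with
    | zero => simp
    | add y₁ y₂ h₁ h₂ => rw [mul_add, map_add, h₁, h₂, map_add, mul_add]
    | tmul s c =>
      rw [Algebra.TensorProduct.tmul_mul_tmul, evalTensor_tmul, evalTensor_tmul, evalTensor_tmul,
        hφ, smul_mul_smul_comm]

variable [StarRing R] [TrivialStar R] [StarModule ℝ R] [StarRing A] [StarModule ℝ A]

theorem isSelfAdjoint_tmul_one (r : R) : IsSelfAdjoint (r ⊗ₜ[ℝ] (1 : A)) := by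
  rw [isSelfAdjoint_iff, TensorProduct.star_tmul, star_trivial, star_one]

theorem evalTensor_star (φ : R →ₗ[ℝ] ℝ) (x : R ⊗[ℝ] A) :
    evalTensor A φ (star x) = star (evalTensor A φ x) := by
  induction x with
  | zero => simp
  | add x y hx hy => rw [star_add, map_add, hx, hy, map_add, star_add]
  | tmul r a =>
    rw [TensorProduct.star_tmul, evalTensor_tmul, evalTensor_tmul, star_smul, star_trivial r,
      star_trivial (φ r)]

variable {M : Set (R ⊗[ℝ] A)}

theorem apply_tmul_one_mul_of_mem_extremePoints (hM : IsQuadraticModule M)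
    (hA : IsArchimedean M) {g : R ⊗[ℝ] A →ₗ[ℝ] ℝ}
    (hg : ⇑g ∈ (positiveStates M).extremePoints ℝ) (r : R) (b : R ⊗[ℝ] A) :
    g (r ⊗ₜ[ℝ] 1 * b) = g (r ⊗ₜ[ℝ] 1) * g b := by
  have hsq : ∀ s : R, g ((s * s) ⊗ₜ[ℝ] 1 * b) = g ((s * s) ⊗ₜ[ℝ] 1) * g b := by
    intro s
    obtain ⟨l, -, hl⟩ := hA ((s * s) ⊗ₜ[ℝ] 1) (isSelfAdjoint_tmul_one _)
    -- Scaling $s^2$ by $1/c$ makes $1-u^2\in M$; the extra $1$ keeps $c$ positive.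
    set c : ℝ := l + 1 with hc
    have hc0 : 0 < c := by positivity
    let u : R := (√c)⁻¹ • s
    have hu : (u * u) ⊗ₜ[ℝ] (1 : A) = c⁻¹ • ((s * s) ⊗ₜ[ℝ] (1 : A)) := by
      rw [smul_mul_smul_comm, ← mul_inv, Real.mul_self_sqrt hc0.le, TensorProduct.smul_tmul']
    have hu' : u ⊗ₜ[ℝ] (1 : A) * u ⊗ₜ[ℝ] (1 : A) = c⁻¹ • ((s * s) ⊗ₜ[ℝ] (1 : A)) := by
      rw [Algebra.TensorProduct.tmul_mul_tmul, mul_one, hu]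
    have hmem : 1 - u ⊗ₜ[ℝ] (1 : A) * u ⊗ₜ[ℝ] (1 : A) ∈ M := by
      rw [hu']
      convert hM.smul_mem (inv_nonneg.2 hc0.le) (hM.add_mem _ hl _ hM.one_mem) using 1
      have : (1 : R ⊗[ℝ] A) = c⁻¹ • (c • 1) := by rw [inv_smul_smul₀ hc0.ne']
      nth_rw 1 [this]
      rw [← smul_sub, hc, add_smul, one_smul, Nat.cast_smul_eq_nsmul, nsmul_one]
      congr 1
      abel
    have := apply_sq_mul_of_mem_extremePoints hM hA hg (commute_tmul_one u)
      (isSelfAdjoint_tmul_one u) hmem b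
    rw [hu', smul_mul_assoc, map_smul, map_smul, smul_eq_mul, smul_eq_mul, mul_assoc] at this
    exact mul_left_cancel₀ (inv_ne_zero hc0.ne') this
  rw [eq_sq_sub_sq r, TensorProduct.sub_tmul, sub_mul, map_sub, map_sub, hsq, hsq, sub_mul]

theorem exists_factorization_nonpos (hM : IsQuadraticModule M) (hA : IsArchimedean M)
    {p : R ⊗[ℝ] A} (hp : IsSelfAdjoint p)
    (hpM : ∀ ε : ℝ, 0 < ε → p - algebraMap ℝ (R ⊗[ℝ] A) ε ∉ M) :
    ∃ (φ : R →ₗ[ℝ] ℝ) (g : A →ₗ[ℝ] ℝ), IsMultiplicativeState φ ∧ g 1 = 1 ∧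
      (∀ m ∈ M, 0 ≤ g (evalTensor A φ m)) ∧ g (evalTensor A φ p) ≤ 0 := by
  obtain ⟨f, hf, hfp⟩ := exists_extremePoint_nonpos hM hA hp hpM
  obtain ⟨G, hpos, hone, rfl⟩ := extremePoints_subset hf
  let φ : R →ₗ[ℝ] ℝ := G ∘ₗ (TensorProduct.mk ℝ R A).flip 1
  let g : A →ₗ[ℝ] ℝ := G ∘ₗ TensorProduct.mk ℝ R A 1
  have hmul := apply_tmul_one_mul_of_mem_extremePoints hM hA hf
  have hφ : ∀ r s, φ (r * s) = φ r * φ s := fun r s => by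
    have := hmul r (s ⊗ₜ[ℝ] 1)
    rwa [Algebra.TensorProduct.tmul_mul_tmul, mul_one] at this
  have hG : ∀ x, g (evalTensor A φ x) = G x := by
    intro x
    induction x with
    | zero => simp
    | add x y hx hy => rw [map_add, map_add, map_add, hx, hy]
    | tmul r a =>
      rw [evalTensor_tmul, map_smul, smul_eq_mul]
      have := hmul r (1 ⊗ₜ[ℝ] a)
      rw [Algebra.TensorProduct.tmul_mul_tmul, mul_one, one_mul] at this
      exact this.symm
  refine ⟨φ, g, ⟨hone, ?_, hφ⟩, hone,
    fun m hm => (hG m).symm ▸ hpos m (realPartCone.subset hM hm), (hG p).symm ▸ hfp⟩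
  rintro x ⟨k, b, rfl⟩
  rw [map_sum]
  refine Finset.sum_nonneg fun i _ => ?_
  rw [hφ, star_trivial]
  exact mul_self_nonneg _

theorem exists_sub_algebraMap_mem (hM : IsQuadraticModule M) (hA : IsArchimedean M)
    {p : R ⊗[ℝ] A} (hp : IsSelfAdjoint p)
    (h : ∀ φ : R →ₗ[ℝ] ℝ, IsMultiplicativeState φ →
      ∃ ε : ℝ, 0 < ε ∧ evalTensor A φ p - algebraMap ℝ A ε ∈ evalTensor A φ '' M) :
    ∃ ε : ℝ, 0 < ε ∧ p - algebraMap ℝ (R ⊗[ℝ] A) ε ∈ M := by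
  by_contra! hpM
  obtain ⟨φ, g, hφ, hg1, hg, hgp⟩ := exists_factorization_nonpos hM hA hp hpM
  obtain ⟨ε, hε, m, hm, hmp⟩ := h φ hφ
  have := hg m hm
  rw [hmp, map_sub, Algebra.algebraMap_eq_smul_one, map_smul, hg1, smul_eq_mul, mul_one] at this
  linarith

theorem exists_sum_conj_sub_one_mem (hM : IsQuadraticModule M) (hA : IsArchimedean M)
    {p : R ⊗[ℝ] A} (hp : IsSelfAdjoint p)
    (h : ∀ φ : R →ₗ[ℝ] ℝ, IsMultiplicativeState φ →
      ∃ (k : ℕ) (d : Fin k → A),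
        (∑ i, star (d i) * evalTensor A φ p * d i) - 1 ∈ evalTensor A φ '' M) :
    ∃ (k : ℕ) (c : Fin k → R ⊗[ℝ] A), (∑ i, star (c i) * p * c i) - 1 ∈ M := by
  by_contra! hpM
  -- $N$ adjoins all $-c^\ast pc$ to $M$; failure of the claim says exactly that $-1\notin N$.
  let N : Set (R ⊗[ℝ] A) :=
    {x | ∃ (k : ℕ) (c : Fin k → R ⊗[ℝ] A), x + ∑ i, star (c i) * p * c i ∈ M}
  have hMN : M ⊆ N := fun m hm => ⟨0, Fin.elim0, by simpa using hm⟩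
  have hsa : ∀ c, IsSelfAdjoint (star c * p * c) := fun c => hp.conjugate' c
  have hN : IsQuadraticModule N :=
    { isSelfAdjoint := by
        rintro x ⟨k, c, hx⟩
        have h₁ := hM.isSelfAdjoint _ hx
        have h₂ : IsSelfAdjoint (∑ i, star (c i) * p * c i) :=
          isSelfAdjoint_sum _ fun i _ => hsa (c i)
        simpa using h₁.sub h₂
      one_mem := hMN hM.one_mem
      add_mem := by
        rintro x ⟨k, c, hx⟩ y ⟨k', c', hy⟩
        refine ⟨k + k', Fin.append c c', ?_⟩
        convert hM.add_mem _ hx _ hy using 1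
        simp only [Fin.sum_univ_add, Fin.append_left, Fin.append_right]
        abel
      conj_mem := by
        rintro b x ⟨k, c, hx⟩
        refine ⟨k, fun i => c i * b, ?_⟩
        convert hM.conj_mem b _ hx using 1
        simp only [mul_add, add_mul, Finset.mul_sum, Finset.sum_mul, star_mul, mul_assoc] }
  have hconj : ∀ c, -(star c * p * c) ∈ N := fun c =>
    ⟨1, fun _ => c, by simpa using hM.zero_mem⟩
  obtain ⟨φ, g, hφ, hg1, hg, -⟩ := exists_factorization_nonpos hN (hA.mono hMN)
    (p := -1) (IsSelfAdjoint.one _).neg (fun ε hε hmem => by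
      have := hN.add_mem _ hmem _ (hN.algebraMap_mem hε.le)
      rw [sub_add_cancel] at this
      obtain ⟨k, c, hc⟩ := this
      refine hpM k c ?_
      rwa [neg_add_eq_sub] at hc)
  obtain ⟨k, d, m, hm, hmd⟩ := h φ hφ
  have h₁ := hg m (hMN hm)
  rw [hmd, map_sub, hg1, map_sum] at h₁
  -- Each $-(1\otimes d_i)^\ast p(1\otimes d_i)$ lies in $N$, whereas `h₁` forces this sum to be at
  -- least $1$.
  have h₂ : ∑ i, g (star (d i) * evalTensor A φ p * d i) ≤ 0 := by
    refine Finset.sum_nonpos fun i _ => ?_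
    have := hg _ (hconj (1 ⊗ₜ[ℝ] d i))
    rw [map_neg, evalTensor_mul hφ.map_mul, evalTensor_mul hφ.map_mul, evalTensor_star,
      evalTensor_tmul, hφ.map_one, one_smul, map_neg] at this
    linarith
  linarith

/-! ### Archimedean property of $M$ from that of $\Sigma^2A$ and $M\cap R$ -/

/-- With $l\pm a\in\Sigma^2A$ and $k-ls^2\in M\cap R$, one has $k\pm s^2\otimes a=(k-s^2\otimes
l)+s^2\otimes(l\pm a)$. -/
theorem exists_natCast_add_sub_mem_of_sq (hM : IsQuadraticModule M)
    (hA : IsAlgebraicallyBounded A) (hR : IsArchimedean {r : R | r ⊗ₜ[ℝ] (1 : A) ∈ M})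
    (s : R) {a : A} (ha : IsSelfAdjoint a) :
    ∃ l : ℕ, (l : R ⊗[ℝ] A) + (s * s) ⊗ₜ[ℝ] a ∈ M ∧ (l : R ⊗[ℝ] A) - (s * s) ⊗ₜ[ℝ] a ∈ M := by
  have hsq : ∀ x ∈ sumsOfHermitianSquares A, (s * s) ⊗ₜ[ℝ] x ∈ M := by
    rintro _ ⟨k, b, rfl⟩
    rw [TensorProduct.tmul_sum]
    refine hM.sum_mem _ _ fun i _ => ?_
    have := hM.conj_mem (s ⊗ₜ[ℝ] b i) 1 hM.one_mem
    rwa [mul_one, TensorProduct.star_tmul, star_trivial,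
      Algebra.TensorProduct.tmul_mul_tmul] at this
  obtain ⟨l, h₁, h₂⟩ := hA a ha
  obtain ⟨k, -, hk⟩ := hR ((l : R) * (s * s)) (IsSelfAdjoint.all _)
  have hk : (k : R ⊗[ℝ] A) - (s * s) ⊗ₜ[ℝ] (l : A) ∈ M := by
    have e : ((k : R) - l * (s * s)) ⊗ₜ[ℝ] (1 : A) = k - (s * s) ⊗ₜ[ℝ] (l : A) := by
      rw [TensorProduct.sub_tmul, ← nsmul_eq_mul, ← TensorProduct.smul_tmul', ← nsmul_one,
        ← nsmul_one (A := A), TensorProduct.tmul_smul, ← TensorProduct.smul_tmul',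
        ← Algebra.TensorProduct.one_def, nsmul_one]
    exact e ▸ hk
  refine ⟨k, ?_, ?_⟩
  · convert hM.add_mem _ hk _ (hsq _ h₁) using 1
    rw [TensorProduct.tmul_add]
    abel
  · convert hM.add_mem _ hk _ (hsq _ h₂) using 1
    rw [TensorProduct.tmul_sub]
    abel

theorem isArchimedean_of_isAlgebraicallyBounded (hM : IsQuadraticModule M)
    (hA : IsAlgebraicallyBounded A) (hR : IsArchimedean {r : R | r ⊗ₜ[ℝ] (1 : A) ∈ M}) :
    IsArchimedean M := by
  let H : AddSubgroup (R ⊗[ℝ] A) :=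
    { carrier := {x | ∃ l : ℕ, (l : R ⊗[ℝ] A) + x ∈ M ∧ (l : R ⊗[ℝ] A) - x ∈ M}
      zero_mem' := ⟨0, by simp [hM.zero_mem]⟩
      add_mem' := by
        rintro x y ⟨k, h₁, h₂⟩ ⟨l, h₃, h₄⟩
        refine ⟨k + l, ?_, ?_⟩
        · convert hM.add_mem _ h₁ _ h₃ using 1
          push_cast
          abel
        · convert hM.add_mem _ h₂ _ h₄ using 1
          push_cast
          abel
      neg_mem' := by
        rintro x ⟨k, h₁, h₂⟩
        exact ⟨k, by rwa [← sub_eq_add_neg], by rwa [sub_neg_eq_add]⟩ }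
  have htmul : ∀ (r : R) (a : A), IsSelfAdjoint a → r ⊗ₜ[ℝ] a ∈ H := by
    intro r a ha
    rw [eq_sq_sub_sq r, TensorProduct.sub_tmul]
    exact H.sub_mem (exists_natCast_add_sub_mem_of_sq hM hA hR _ ha)
      (exists_natCast_add_sub_mem_of_sq hM hA hR _ ha)
  -- A hermitian tensor need not come with hermitian factors; symmetrising reduces to
  -- $r\otimes(a+a^\ast)$.
  have hadd : ∀ x : R ⊗[ℝ] A, x + star x ∈ H := by
    intro x
    induction x with
    | zero => simp [H.zero_mem]
    | add x y hx hy =>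
      convert H.add_mem hx hy using 1
      rw [star_add]
      abel
    | tmul r a =>
      rw [TensorProduct.star_tmul, star_trivial, ← TensorProduct.tmul_add]
      exact htmul r _ (IsSelfAdjoint.add_star_self a)
  intro x hx
  have := hadd ((1 / 2 : ℝ) • x)
  rw [star_smul, star_trivial, hx.star_eq, ← add_smul, add_halves, one_smul] at this
  exact this

end TensorProduct

theorem mainTheorem1 (F : Type*) [RCLike F]
    {R : Type*} [CommRing R] [StarRing R] [TrivialStar R] [Algebra ℝ R] [StarModule ℝ R]
    {A : Type*} [Ring A] [StarRing A] [Algebra F A] [StarModule F A]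
    [Algebra ℝ A] [IsScalarTower ℝ F A] [StarModule ℝ A]
    (M : Set (R ⊗[ℝ] A)) (hM : IsQuadraticModule M) :
    (IsArchimedean M → ∀ p : R ⊗[ℝ] A, IsSelfAdjoint p →
      ((∃ ε : ℝ, 0 < ε ∧ p - algebraMap ℝ (R ⊗[ℝ] A) ε ∈ M) ↔
        ∀ φ : R →ₗ[ℝ] ℝ, IsMultiplicativeState φ →
          ∃ ε : ℝ, 0 < ε ∧ evalTensor A φ p - algebraMap ℝ A ε ∈ evalTensor A φ '' M) ∧
      ((∀ ε : ℝ, 0 < ε → p + algebraMap ℝ (R ⊗[ℝ] A) ε ∈ M) ↔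
        ∀ φ : R →ₗ[ℝ] ℝ, IsMultiplicativeState φ →
          ∀ ε : ℝ, 0 < ε → evalTensor A φ p + algebraMap ℝ A ε ∈ evalTensor A φ '' M) ∧
      ((∃ (k : ℕ) (c : Fin k → R ⊗[ℝ] A), (∑ i, star (c i) * p * c i) - 1 ∈ M) ↔
        ∀ φ : R →ₗ[ℝ] ℝ, IsMultiplicativeState φ →
          ∃ (k : ℕ) (d : Fin k → A),
            (∑ i, star (d i) * evalTensor A φ p * d i) - 1 ∈ evalTensor A φ '' M)) ∧
    (IsAlgebraicallyBounded A →
      IsArchimedean {r : R | r ⊗ₜ[ℝ] (1 : A) ∈ M} →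
      IsArchimedean M) := by
  refine ⟨fun hA p hp => ⟨⟨?_, exists_sub_algebraMap_mem hM hA hp⟩, ⟨?_, ?_⟩,
    ⟨?_, exists_sum_conj_sub_one_mem hM hA hp⟩⟩, isArchimedean_of_isAlgebraicallyBounded hM⟩
  · rintro ⟨ε, hε, h⟩ φ hφ
    exact ⟨ε, hε, _, h, by rw [map_sub, evalTensor_algebraMap hφ.map_one]⟩
  · intro h φ hφ ε hε
    exact ⟨_, h ε hε, by rw [map_add, evalTensor_algebraMap hφ.map_one]⟩
  · intro h δ hδ
    obtain ⟨ε, hε, hmem⟩ := exists_sub_algebraMap_mem hM hA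
      (p := p + algebraMap ℝ _ δ) (hp.add (IsSelfAdjoint.algebraMap _ (IsSelfAdjoint.all δ)))
      -- Half of the shift $\delta$ serves as the strict margin, the other half is the $\varepsilon$
      -- of (2').
      (fun φ hφ => ⟨δ / 2, half_pos hδ, by
        rw [map_add, evalTensor_algebraMap hφ.map_one, add_sub_assoc, ← map_sub, sub_half]
        exact h φ hφ (δ / 2) (half_pos hδ)⟩)
    have := hM.add_mem _ hmem _ (hM.algebraMap_mem hε.le)
    rwa [sub_add_cancel] at this
  · rintro ⟨k, c, h⟩ φ hφ
    refine ⟨k, fun i => evalTensor A φ (c i), _, h, ?_⟩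
    simp only [map_sub, map_sum, evalTensor_mul hφ.map_mul, evalTensor_star,
      evalTensor_one hφ.map_one]
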